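/- There is a universal constant $A_0>0$ such that for every $A\ge A_0$ there is a constant $C>0$, depending only on $A$, for which the following holds. Let $n,p,m$ be arbitrary, let $X\in\mathbb R^{n\times p}$ and $B^*\in\mathbb R^{p\times m}$ be deterministic matrices, let $\sigma\ge 0$, and let $Y=XB^*+E$, where the random vector $\mathrm{vec}(E)$ is sub-Gaussian with mean zero and scale bounded by $\sigma$. Here a random variable $\xi$ is sub-Gaussian if $\mathbb P(|\xi|\ge t)\le C'e^{-c't^2}$ for all $t>0$ and some constants $C',c'>0$; its scale is $\sigma(\xi)=\inf\{s>0:\mathbb E\exp(\xi^2/s^2)\le 2\}$; and a random vector $\xi$ is sub-Gaussian with scale bounded by $\sigma$ if, for every deterministic vector $\alpha$, $\langle\xi,\alpha\rangle$ is sub-Gaussian with $\sigma(\langle\xi,\alpha\rangle)\le\sigma\|\alpha\|_2$. For $B\in\mathbb R^{p\times m}$ let $r(B)$ be its rank, $J(B)$ the number of its nonzero rows, $q=\operatorname{rank}(X)$, and $$P_o(B)=[\,q\wedge J(B)+m-r(B)\,]\,r(B)+J(B)\log\bigl(ep/J(B)\bigr).$$ Let $(B_l)_l$ be any collection of nonzero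 matrices in $\mathbb R^{p\times m}$, possibly random (and possibly dependent on $E$), and let $\hat B$ be a member of the collection that minimizes, over the collection, $$\tfrac12\|Y-XB_l\|_F^2+A\sigma^2P_o(B_l).$$ Then $$\mathbb E\bigl[\|X\hat B-XB^*\|_F^2\bigr]\le C\,\inf_l\,\mathbb E\bigl[\|XB_l-XB^*\|_F^2+\sigma^2P_o(B_l)\bigr].$$ (Expectations take values in $[0,\infty]$. No incoherence or signal-strength condition is imposed.) -/

import Mathlib

open MeasureTheory
open scoped ENNReal Matrix Matrix.Norms.Frobenius

noncomputable section

/-- A real random variable is sub-Gaussian if `P(|ξ| ≥ t) ≤ C exp(-c t²)` for all `t > 0` and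
some constants `C, c > 0`. -/
def IsSubGaussian {Ω : Type*} [MeasurableSpace Ω] (ξ : Ω → ℝ) (μ : Measure Ω) : Prop :=
  ∃ C c : ℝ, 0 < C ∧ 0 < c ∧
    ∀ t : ℝ, 0 < t → μ {ω | t ≤ |ξ ω|} ≤ ENNReal.ofReal (C * Real.exp (-c * t ^ 2))

/-- The scale `inf {s > 0 : E exp(ξ² / s²) ≤ 2}` of a random variable. (The set is nonempty when
`ξ` is sub-Gaussian; the expectation is allowed to be infinite.) -/
def subGaussianScale {Ω : Type*} [MeasurableSpace Ω] (ξ : Ω → ℝ) (μ : Measure Ω) : ℝ :=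
  sInf {s : ℝ | 0 < s ∧ ∫⁻ ω, ENNReal.ofReal (Real.exp (ξ ω ^ 2 / s ^ 2)) ∂μ ≤ 2}

/-- A random vector is sub-Gaussian with scale bounded by `σ` if each linear functional
`⟨ξ, α⟩` is sub-Gaussian with scale at most `σ ‖α‖₂`. -/
structure IsSubGaussianVector {Ω κ : Type*} [MeasurableSpace Ω] [Fintype κ]
    (ξ : Ω → EuclideanSpace ℝ κ) (σ : ℝ) (μ : Measure Ω) : Prop where
  aemeasurable : AEMeasurable ξ μ
  isSubGaussian : ∀ α : EuclideanSpace ℝ κ, IsSubGaussian (fun ω => inner ℝ (ξ ω) α) μ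
  scale_le : ∀ α : EuclideanSpace ℝ κ,
    subGaussianScale (fun ω => inner ℝ (ξ ω) α) μ ≤ σ * ‖α‖

open Classical in
/-- The row support of `B`: the set of indices of its nonzero rows. -/
def rowSupport {p m : ℕ} (B : Matrix (Fin p) (Fin m) ℝ) : Finset (Fin p) :=
  Finset.univ.filter fun j => B.row j ≠ 0

/-- The complexity `P_o(B) = [q ∧ J(B) + m - r(B)] r(B) + J(B) log(e p / J(B))`, where
`q` is the rank of the design, `J(B)` the number of nonzero rows and `r(B)` the rank of `B`. -/
def complexityPo {n p m : ℕ} (X : Matrix (Fin n) (Fin p) ℝ) (B : Matrix (Fin p) (Fin m) ℝ) : ℝ :=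
  (min (X.rank : ℝ) ((rowSupport B).card : ℝ) + (m : ℝ) - (B.rank : ℝ)) * (B.rank : ℝ)
    + ((rowSupport B).card : ℝ) * Real.log (Real.exp 1 * (p : ℝ) / ((rowSupport B).card : ℝ))

/-- The predictive information criterion `½ ‖Y - X B‖_F² + A σ² P_o(B)`; `‖·‖` is the
Frobenius norm. -/
def predictiveIC {n p m : ℕ} (X : Matrix (Fin n) (Fin p) ℝ) (Y : Matrix (Fin n) (Fin m) ℝ)
    (σ A : ℝ) (B : Matrix (Fin p) (Fin m) ℝ) : ℝ :=
  1 / 2 * ‖Y - X * B‖ ^ 2 + A * σ ^ 2 * complexityPo X B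

end

/-! Comparing the criterion at `Bhat` with any competitor `B'` bounds `½‖X Bhat - X Bstar‖²` by the
same quantity at `B'`, plus the penalty difference, plus `⟨E, X Bhat - X B'⟩`. Since `Bhat` depends
on `E`, this inner product must be controlled simultaneously for all pairs of matrices, at the price
of their complexities.

A rank-`k` matrix with columns in a subspace `U` factors as `Q R` through `ℝᵏ`, so nets of the two
unit balls give at most `5 ^ (k (dim U + m))` test points (`exists_lowRank_net`). A weighted union
bound over supports, ranks and test points (`exists_class_nets`, `exists_uniform_sq_bound`) puts all
fluctuations into one variable `W` with expectation at most 16.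

A difference `X B - X B'` is split orthogonally: its projection onto the smaller of the two column
spans, and the residual, which only the other matrix feeds (`add_family_le`). Hence the cost is the
sum of two complexities, with no cross term between the larger rank and the larger dimension. For `A
≥ 1536` the penalty absorbs the complexity of `Bhat`; the remaining `σ² W` is paid for by `P_o ≥ 1`
on nonzero matrices. -/

/-! ### Finite nets for low-rank families -/

open Module in
/-- In a finite-dimensional normed space, a linear functional is controlled on the unit ball by
its values on a half-net of cardinality at most `5 ^ dim`. -/
theorem exists_norming_finset (V : Type*) [NormedAddCommGroup V] [NormedSpace ℝ V]
    [FiniteDimensional ℝ V] :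
    ∃ T : Finset V, T.card ≤ 5 ^ finrank ℝ V ∧ (∀ t ∈ T, ‖t‖ ≤ 1) ∧
      ∀ (f : V →ₗ[ℝ] ℝ) (c : ℝ), (∀ t ∈ T, f t ≤ c) → ∀ v, ‖v‖ ≤ 1 → f v ≤ 2 * c := by
  classical
  let P : Finset V → Prop := fun s =>
    (∀ x ∈ s, ‖x‖ ≤ 1) ∧ ∀ x ∈ s, ∀ y ∈ s, x ≠ y → 1 / 2 ≤ ‖x - y‖
  have hcard : ∀ s, P s → s.card ≤ 5 ^ finrank ℝ V := by
    intro s hs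
    -- Doubling turns a 1/2-separated set in the unit ball into a 1-separated set in the ball of
    -- radius 2, the normalisation of `Besicovitch.card_le_of_separated`.
    have hinj : Function.Injective fun x : V => (2 : ℝ) • x :=
      smul_right_injective V (by norm_num)
    rw [← Finset.card_image_of_injective s hinj]
    refine Besicovitch.card_le_of_separated _ ?_ ?_
    · intro c hc
      obtain ⟨x, hx, rfl⟩ := Finset.mem_image.1 hc
      rw [norm_smul, Real.norm_of_nonneg (by norm_num)]
      linarith [hs.1 x hx]
    · intro c hc d hd hcd
      obtain ⟨x, hx, rfl⟩ := Finset.mem_image.1 hc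
      obtain ⟨y, hy, rfl⟩ := Finset.mem_image.1 hd
      have hxy : x ≠ y := fun h => hcd (by rw [h])
      rw [← smul_sub, norm_smul, Real.norm_of_nonneg (by norm_num)]
      linarith [hs.2 x hx y hy hxy]
  let N : Set ℕ := {k | ∃ s, P s ∧ s.card = k}
  have hN : N.Nonempty := ⟨0, ∅, ⟨by simp, by simp⟩, rfl⟩
  have hbdd : BddAbove N := ⟨5 ^ finrank ℝ V, by rintro _ ⟨s, hs, rfl⟩; exact hcard s hs⟩
  obtain ⟨T, hT, hTcard⟩ := Nat.sSup_mem hN hbdd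
  -- A separated set of maximal cardinality is a net: a point far from it could be added.
  have hnet : ∀ v : V, ‖v‖ ≤ 1 → ∃ t ∈ T, ‖v - t‖ ≤ 1 / 2 := by
    intro v hv
    by_contra! hcon
    have hvT : v ∉ T := fun h => by
      have := hcon v h
      rw [sub_self, norm_zero] at this
      norm_num at this
    have hP : P (insert v T) := by
      refine ⟨?_, ?_⟩
      · intro x hx
        rcases Finset.mem_insert.1 hx with rfl | hx
        exacts [hv, hT.1 x hx]
      · intro x hx y hy hxy
        rcases Finset.mem_insert.1 hx with hxv | hxT <;>
          rcases Finset.mem_insert.1 hy with hyv | hyT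
        · exact absurd (hxv.trans hyv.symm) hxy
        · exact hxv ▸ (hcon y hyT).le
        · rw [norm_sub_rev]; exact hyv ▸ (hcon x hxT).le
        · exact hT.2 x hxT y hyT hxy
    have := le_csSup hbdd (show (insert v T).card ∈ N from ⟨_, hP, rfl⟩)
    rw [Finset.card_insert_of_notMem hvT, hTcard] at this
    omega
  refine ⟨T, hcard T hT, hT.1, fun f c hf v hv => ?_⟩
  let F := LinearMap.toContinuousLinearMap f
  have hFf : ∀ x, F x = f x := fun x => rfl
  obtain ⟨t₀, ht₀, -⟩ := hnet 0 (by simp)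
  have hstep : ∀ x, ‖x‖ ≤ 1 → f x ≤ c + ‖F‖ * (1 / 2) := by
    intro x hx
    obtain ⟨t, ht, hxt⟩ := hnet x hx
    have h1 : f (x - t) ≤ ‖F‖ * ‖x - t‖ := (le_abs_self _).trans (F.le_opNorm (x - t))
    have h2 : f (x - t) = f x - f t := map_sub f x t
    have h3 := mul_le_mul_of_nonneg_left hxt (norm_nonneg F)
    linarith [hf t ht]
  have hc0 : 0 ≤ c + ‖F‖ * (1 / 2) := by simpa using hstep 0 (by simp)
  -- The net error is absorbed in the norm itself, which gives `‖F‖ ≤ 2 * c`.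
  have hnorm : ‖F‖ ≤ c + ‖F‖ * (1 / 2) := by
    refine F.opNorm_le_of_unit_norm hc0 fun x hx => ?_
    rw [Real.norm_eq_abs, abs_le, hFf]
    refine ⟨?_, hstep x hx.le⟩
    have := hstep (-x) (by rw [norm_neg, hx])
    rw [map_neg] at this
    linarith
  have := hstep v hv
  linarith

/-- The family of images `Q (R j)` of a family of vectors `R`, bilinear in `Q` and `R`. -/
def applyFamily {K H : Type*} [NormedAddCommGroup K] [InnerProductSpace ℝ K]
    [NormedAddCommGroup H] [InnerProductSpace ℝ H] (U : Submodule ℝ H) (m : ℕ) :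
    (K →L[ℝ] U) →ₗ[ℝ] PiLp 2 (fun _ : Fin m => K) →ₗ[ℝ] PiLp 2 (fun _ : Fin m => H) :=
  LinearMap.mk₂ ℝ (fun Q R => WithLp.toLp 2 fun j => (Q (R j) : H))
    (fun _ _ _ => by ext j; simp) (fun _ _ _ => by ext j; simp)
    (fun _ _ _ => by ext j; simp) (fun _ _ _ => by ext j; simp)

theorem applyFamily_apply {K H : Type*} [NormedAddCommGroup K] [InnerProductSpace ℝ K]
    [NormedAddCommGroup H] [InnerProductSpace ℝ H] (U : Submodule ℝ H) (m : ℕ)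
    (Q : K →L[ℝ] U) (R : PiLp 2 (fun _ : Fin m => K)) (j : Fin m) :
    applyFamily U m Q R j = Q (R j) := rfl

theorem norm_applyFamily_le {K H : Type*} [NormedAddCommGroup K] [InnerProductSpace ℝ K]
    [NormedAddCommGroup H] [InnerProductSpace ℝ H] (U : Submodule ℝ H) (m : ℕ)
    (Q : K →L[ℝ] U) (R : PiLp 2 (fun _ : Fin m => K)) :
    ‖applyFamily U m Q R‖ ≤ ‖Q‖ * ‖R‖ := by
  refine abs_le_of_sq_le_sq' ?_ (by positivity) |>.2
  rw [mul_pow, PiLp.norm_sq_eq_of_L2, PiLp.norm_sq_eq_of_L2, Finset.mul_sum]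
  refine Finset.sum_le_sum fun j _ => ?_
  rw [← mul_pow]
  exact pow_le_pow_left₀ (norm_nonneg _) (Q.le_opNorm (R j)) 2

open Module in
/-- A family of vectors of a subspace `U` spanning a `k`-dimensional space factors through an
isometric embedding of `ℝᵏ` into `U`. -/
theorem exists_applyFamily_eq {H : Type*} [NormedAddCommGroup H] [InnerProductSpace ℝ H]
    [FiniteDimensional ℝ H] (U : Submodule ℝ H) {m : ℕ} (k : ℕ)
    (M : PiLp 2 (fun _ : Fin m => H)) (hMU : ∀ j, M j ∈ U)
    (hk : finrank ℝ (Submodule.span ℝ (Set.range fun j => M j)) = k) :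
    ∃ (Q : EuclideanSpace ℝ (Fin k) →L[ℝ] U) (R : PiLp 2 fun _ : Fin m => EuclideanSpace ℝ (Fin k)),
      ‖Q‖ ≤ 1 ∧ ‖R‖ = ‖M‖ ∧ applyFamily U m Q R = M := by
  subst hk
  set W := Submodule.span ℝ (Set.range fun j => M j) with hW
  have hWU : W ≤ U := Submodule.span_le.2 (by rintro _ ⟨j, rfl⟩; exact hMU j)
  have hMW : ∀ j, M j ∈ W := fun j => Submodule.subset_span ⟨j, rfl⟩
  let e := (stdOrthonormalBasis ℝ W).repr
  let Q₀ : EuclideanSpace ℝ (Fin (finrank ℝ W)) →ₗ[ℝ] U :=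
    (Submodule.inclusion hWU) ∘ₗ e.symm.toLinearEquiv.toLinearMap
  have hQ₀ : ∀ x, (Q₀ x : H) = (e.symm x : H) := fun x => rfl
  refine ⟨LinearMap.toContinuousLinearMap Q₀, WithLp.toLp 2 fun j => e ⟨M j, hMW j⟩, ?_, ?_, ?_⟩
  · refine ContinuousLinearMap.opNorm_le_bound _ zero_le_one fun x => ?_
    rw [one_mul]
    change ‖(Q₀ x : H)‖ ≤ ‖x‖
    rw [hQ₀, ← Submodule.coe_norm, e.symm.norm_map]
  · rw [← sq_eq_sq₀ (norm_nonneg _) (norm_nonneg _), PiLp.norm_sq_eq_of_L2, PiLp.norm_sq_eq_of_L2]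
    refine Finset.sum_congr rfl fun j _ => ?_
    change ‖e ⟨M j, hMW j⟩‖ ^ 2 = _
    rw [e.norm_map]
    rfl
  · ext1 j
    rw [applyFamily_apply]
    change ((Q₀ (e ⟨M j, hMW j⟩) : U) : H) = _
    rw [hQ₀, e.symm_apply_apply]

open Module in
/-- Linear functionals on families of vectors in `U` with `k`-dimensional span are controlled by
their values on finitely many points of the unit ball. -/
theorem exists_lowRank_net {H : Type*} [NormedAddCommGroup H] [InnerProductSpace ℝ H]
    [FiniteDimensional ℝ H] (U : Submodule ℝ H) (m k : ℕ) :
    ∃ T : Finset (PiLp 2 fun _ : Fin m => H), T.card ≤ 5 ^ (k * (finrank ℝ U + m)) ∧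
      (∀ t ∈ T, ‖t‖ ≤ 1) ∧
      ∀ (f : (PiLp 2 fun _ : Fin m => H) →ₗ[ℝ] ℝ) (c : ℝ), (∀ t ∈ T, f t ≤ c) →
        ∀ M : PiLp 2 fun _ : Fin m => H, (∀ j, M j ∈ U) →
          finrank ℝ (Submodule.span ℝ (Set.range fun j => M j)) = k → f M ≤ 4 * c * ‖M‖ := by
  classical
  obtain ⟨T₁, hT₁card, hT₁norm, hT₁⟩ :=
    exists_norming_finset (EuclideanSpace ℝ (Fin k) →L[ℝ] U)
  obtain ⟨T₂, hT₂card, hT₂norm, hT₂⟩ :=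
    exists_norming_finset (PiLp 2 fun _ : Fin m => EuclideanSpace ℝ (Fin k))
  have hd₁ : finrank ℝ (EuclideanSpace ℝ (Fin k) →L[ℝ] U) = k * finrank ℝ U := by
    rw [← (LinearMap.toContinuousLinearMap (𝕜 := ℝ)
      (E := EuclideanSpace ℝ (Fin k)) (F' := U)).finrank_eq, finrank_linearMap]
    simp
  have hd₂ : finrank ℝ (PiLp 2 fun _ : Fin m => EuclideanSpace ℝ (Fin k)) = k * m := by
    rw [(WithLp.linearEquiv 2 ℝ (Fin m → EuclideanSpace ℝ (Fin k))).finrank_eq,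
      finrank_pi_fintype]
    simp [mul_comm]
  rw [hd₁] at hT₁card
  rw [hd₂] at hT₂card
  refine ⟨(T₁ ×ˢ T₂).image fun x => applyFamily U m x.1 x.2, ?_, ?_, ?_⟩
  · calc _ ≤ (T₁ ×ˢ T₂).card := Finset.card_image_le
      _ = T₁.card * T₂.card := Finset.card_product _ _
      _ ≤ 5 ^ (k * finrank ℝ U) * 5 ^ (k * m) := Nat.mul_le_mul hT₁card hT₂card
      _ = _ := by rw [← pow_add, mul_add]
  · intro t ht
    obtain ⟨⟨Q, R⟩, hx, rfl⟩ := Finset.mem_image.1 ht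
    obtain ⟨hQ, hR⟩ := Finset.mem_product.1 hx
    exact (norm_applyFamily_le U m Q R).trans
      (mul_le_one₀ (hT₁norm Q hQ) (norm_nonneg _) (hT₂norm R hR))
  · intro f c hf M hMU hk
    obtain ⟨Q, R, hQ, hR, rfl⟩ := exists_applyFamily_eq U k M hMU hk
    -- Each of the two factors, freed in turn from its net by bilinearity, costs a factor 2.
    have key : ∀ R, ‖R‖ ≤ 1 → f (applyFamily U m Q R) ≤ 2 * (2 * c) := by
      intro R hR
      refine hT₁ (f ∘ₗ (applyFamily U m).flip R) (2 * c) (fun q hq => ?_) Q hQ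
      refine hT₂ (f ∘ₗ applyFamily U m q) c (fun r hr => ?_) R hR
      exact hf _ (Finset.mem_image.2 ⟨(q, r), Finset.mem_product.2 ⟨hq, hr⟩, rfl⟩)
    rw [← hR]
    rcases eq_or_ne R 0 with rfl | hR0
    · simp
    · have hpos : 0 < ‖R‖ := norm_pos_iff.2 hR0
      have h := key (‖R‖⁻¹ • R) (by rw [norm_smul, norm_inv, norm_norm, inv_mul_cancel₀ hpos.ne'])
      rw [map_smul, map_smul, smul_eq_mul, inv_mul_le_iff₀ hpos] at h
      linarith

/-! ### Exponential moments of sub-Gaussian variables -/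

theorem hasDerivAt_exp_mul_sq (a t : ℝ) :
    HasDerivAt (fun t => Real.exp (a * t ^ 2)) (2 * a * t * Real.exp (a * t ^ 2)) t := by
  have h := ((hasDerivAt_pow 2 t).const_mul a).exp
  convert h using 1
  push_cast
  ring

theorem lintegral_Ioi_mul_exp_neg_mul_sq {b : ℝ} (hb : 0 < b) :
    ∫⁻ t in Set.Ioi (0 : ℝ), ENNReal.ofReal (t * Real.exp (-b * t ^ 2)) =
      ENNReal.ofReal (1 / (2 * b)) := by
  have hint : IntegrableOn (fun t : ℝ => t * Real.exp (-b * t ^ 2)) (Set.Ioi 0) :=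
    (integrable_mul_exp_neg_mul_sq hb).integrableOn
  rw [← ofReal_integral_eq_lintegral_ofReal hint]
  · congr 1
    have hderiv : ∀ t : ℝ, HasDerivAt (fun t => (-1 / (2 * b)) * Real.exp (-b * t ^ 2))
        (t * Real.exp (-b * t ^ 2)) t := by
      intro t
      refine ((hasDerivAt_exp_mul_sq (-b) t).const_mul (-1 / (2 * b))).congr_deriv ?_
      field_simp
    rw [integral_Ioi_of_hasDerivAt_of_tendsto (m := 0)
      (hderiv 0).continuousAt.continuousWithinAt (fun t _ => hderiv t) hint]
    · simp; ring
    · rw [← mul_zero (-1 / (2 * b))]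
      refine Filter.Tendsto.const_mul _ (Real.tendsto_exp_atBot.comp ?_)
      exact (Filter.tendsto_pow_atTop two_ne_zero).const_mul_atTop_of_neg (by linarith)
  · exact (ae_restrict_iff' measurableSet_Ioi).2 (Filter.Eventually.of_forall fun t ht =>
      mul_nonneg (le_of_lt ht) (Real.exp_pos _).le)

/-- A sub-Gaussian variable has a square-exponential moment at most `2` at some scale. -/
theorem IsSubGaussian.exists_lintegral_exp_le {Ω : Type*} [MeasurableSpace Ω] {ξ : Ω → ℝ}
    {μ : Measure Ω} [IsProbabilityMeasure μ] (h : IsSubGaussian ξ μ) (hξ : AEMeasurable ξ μ) :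
    ∃ s : ℝ, 0 < s ∧ ∫⁻ ω, ENNReal.ofReal (Real.exp (ξ ω ^ 2 / s ^ 2)) ∂μ ≤ 2 := by
  obtain ⟨C, c, hC, hc, htail⟩ := h
  -- This choice makes `l * C = c - l`, so the layer-cake integral of `exp (l ξ²) - 1` is bounded by
  -- exactly 1.
  set l := c / (C + 1) with hl
  have hl0 : 0 < l := by positivity
  have hlc : l * (C + 1) = c := by rw [hl]; field_simp
  have hlt : 0 < c - l := by nlinarith
  refine ⟨1 / Real.sqrt l, by positivity, ?_⟩
  have hsq : ∀ x : ℝ, x ^ 2 / (1 / Real.sqrt l) ^ 2 = l * x ^ 2 := by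
    intro x
    rw [div_pow, one_pow, Real.sq_sqrt hl0.le]
    field_simp
  simp only [hsq]
  have hlayer := lintegral_comp_eq_lintegral_meas_le_mul (f := fun ω => |ξ ω|)
    (g := fun t => 2 * l * t * Real.exp (l * t ^ 2)) μ
    (Filter.Eventually.of_forall fun ω => abs_nonneg _)
    (measurable_norm.comp_aemeasurable hξ)
    (fun t _ => (Continuous.intervalIntegrable (by fun_prop) _ _))
    ((ae_restrict_iff' measurableSet_Ioi).2 (Filter.Eventually.of_forall fun t ht => by
      have : (0 : ℝ) < t := ht
      positivity))
  have hprim : ∀ x : ℝ, ∫ t in (0 : ℝ)..x, 2 * l * t * Real.exp (l * t ^ 2) =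
      Real.exp (l * x ^ 2) - 1 := by
    intro x
    rw [intervalIntegral.integral_eq_sub_of_hasDerivAt (fun t _ => hasDerivAt_exp_mul_sq l t)
      (Continuous.intervalIntegrable (by fun_prop) _ _)]
    simp
  simp only [hprim, sq_abs] at hlayer
  have hsplit : ∀ ω, ENNReal.ofReal (Real.exp (l * ξ ω ^ 2)) =
      ENNReal.ofReal (Real.exp (l * ξ ω ^ 2) - 1) + 1 := by
    intro ω
    rw [← ENNReal.ofReal_one, ← ENNReal.ofReal_add _ zero_le_one, sub_add_cancel]
    have : 0 ≤ l * ξ ω ^ 2 := by positivity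
    linarith [Real.one_le_exp this]
  simp only [hsplit]
  rw [lintegral_add_right _ measurable_const, hlayer, lintegral_const, measure_univ, one_mul]
  refine le_of_le_of_eq (add_le_add ?_ le_rfl) one_add_one_eq_two
  calc ∫⁻ t in Set.Ioi 0, μ {a | t ≤ |ξ a|} * ENNReal.ofReal (2 * l * t * Real.exp (l * t ^ 2))
      ≤ ∫⁻ t in Set.Ioi 0, ENNReal.ofReal (2 * l * C) *
          ENNReal.ofReal (t * Real.exp (-(c - l) * t ^ 2)) := by
        refine setLIntegral_mono' measurableSet_Ioi fun t ht => ?_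
        have ht' : (0 : ℝ) < t := ht
        refine (mul_le_mul_left (htail t ht') _).trans (le_of_eq ?_)
        rw [← ENNReal.ofReal_mul (by positivity), ← ENNReal.ofReal_mul (by positivity)]
        congr 1
        have : Real.exp (-(c - l) * t ^ 2) = Real.exp (-c * t ^ 2) * Real.exp (l * t ^ 2) := by
          rw [← Real.exp_add]; ring_nf
        rw [this]; ring
    _ = ENNReal.ofReal (2 * l * C * (1 / (2 * (c - l)))) := by
        rw [lintegral_const_mul' _ _ ENNReal.ofReal_ne_top, lintegral_Ioi_mul_exp_neg_mul_sq hlt,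
          ← ENNReal.ofReal_mul (by positivity)]
    _ ≤ 1 := by
        rw [ENNReal.ofReal_le_one]
        rw [mul_one_div, div_le_one (by positivity)]
        nlinarith

/-- Beyond its scale, the square-exponential moment of a sub-Gaussian variable is at most `2`. -/
theorem IsSubGaussian.lintegral_exp_le {Ω : Type*} [MeasurableSpace Ω] {ξ : Ω → ℝ}
    {μ : Measure Ω} [IsProbabilityMeasure μ] (h : IsSubGaussian ξ μ) (hξ : AEMeasurable ξ μ)
    {s : ℝ} (hs : subGaussianScale ξ μ < s) :
    ∫⁻ ω, ENNReal.ofReal (Real.exp (ξ ω ^ 2 / s ^ 2)) ∂μ ≤ 2 := by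
  -- Nonemptiness matters: the infimum of an empty set of reals would be 0 by convention.
  obtain ⟨r, ⟨hr0, hr⟩, hrs⟩ := exists_lt_of_csInf_lt (h.exists_lintegral_exp_le hξ) hs
  refine (lintegral_mono fun ω => ?_).trans hr
  gcongr

/-- Every `s > 0` exceeds the scale, and `x ≤ exp x` then gives `E ξ² ≤ 2 s²`. This settles the
degenerate case `σ = 0`, where division by `σ` is meaningless. -/
theorem IsSubGaussian.ae_eq_zero {Ω : Type*} [MeasurableSpace Ω] {ξ : Ω → ℝ}
    {μ : Measure Ω} [IsProbabilityMeasure μ] (h : IsSubGaussian ξ μ) (hξ : AEMeasurable ξ μ)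
    (hs : subGaussianScale ξ μ ≤ 0) : ∀ᵐ ω ∂μ, ξ ω = 0 := by
  have hbound : ∀ s : ℝ, 0 < s →
      ∫⁻ ω, ENNReal.ofReal (ξ ω ^ 2) ∂μ ≤ ENNReal.ofReal (s ^ 2) * 2 := by
    intro s hs0
    calc ∫⁻ ω, ENNReal.ofReal (ξ ω ^ 2) ∂μ
        ≤ ∫⁻ ω, ENNReal.ofReal (s ^ 2) * ENNReal.ofReal (Real.exp (ξ ω ^ 2 / s ^ 2)) ∂μ := by
          refine lintegral_mono fun ω => ?_
          rw [← ENNReal.ofReal_mul (by positivity)]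
          refine ENNReal.ofReal_le_ofReal ?_
          have h1 := Real.add_one_le_exp (ξ ω ^ 2 / s ^ 2)
          rw [← div_le_iff₀' (by positivity)]
          linarith
      _ ≤ _ := by
          rw [lintegral_const_mul' _ _ ENNReal.ofReal_ne_top]
          gcongr
          exact h.lintegral_exp_le hξ (hs.trans_lt hs0)
  have hzero : ∫⁻ ω, ENNReal.ofReal (ξ ω ^ 2) ∂μ = 0 := by
    refine le_antisymm (ENNReal.le_of_forall_pos_le_add fun ε hε _ => ?_) zero_le
    refine (hbound (Real.sqrt (ε / 2)) (by positivity)).trans ?_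
    rw [Real.sq_sqrt (by positivity), zero_add, ← ENNReal.ofReal_ofNat 2,
      ← ENNReal.ofReal_mul (by positivity), div_mul_cancel₀ _ two_ne_zero]
    simp
  have hmeas : AEMeasurable (fun ω => ENNReal.ofReal (ξ ω ^ 2)) μ :=
    (hξ.pow_const 2).ennreal_ofReal
  filter_upwards [(lintegral_eq_zero_iff' hmeas).1 hzero] with ω hω
  have h2 : ξ ω ^ 2 ≤ 0 := ENNReal.ofReal_eq_zero.1 hω
  exact pow_eq_zero_iff two_ne_zero |>.1 (le_antisymm h2 (sq_nonneg _))

/-- Simultaneous control of the squares of finitely many sub-Gaussian variables, with offsets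
`L i` for which `∑ exp (-L i)` is bounded. -/
theorem exists_uniform_sq_bound {Ω I : Type*} [MeasurableSpace Ω] {μ : Measure Ω}
    [IsProbabilityMeasure μ] (S : Finset I) (ξ : I → Ω → ℝ) (L : I → ℝ) {σ K : ℝ} (hσ : 0 ≤ σ)
    (hK : ∑ i ∈ S, Real.exp (-L i) ≤ K)
    (hsub : ∀ i ∈ S, IsSubGaussian (ξ i) μ) (hmeas : ∀ i ∈ S, AEMeasurable (ξ i) μ)
    (hscale : ∀ i ∈ S, subGaussianScale (ξ i) μ ≤ σ) :
    ∃ W : Ω → ℝ, AEMeasurable W μ ∧ (∀ ω, 0 ≤ W ω) ∧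
      ∫⁻ ω, ENNReal.ofReal (W ω) ∂μ ≤ ENNReal.ofReal K * 2 ∧
      ∀ᵐ ω ∂μ, ∀ i ∈ S, ξ i ω ^ 2 ≤ 4 * σ ^ 2 * (L i + W ω) := by
  rcases hσ.eq_or_lt with rfl | hσ
  · refine ⟨fun _ => 0, aemeasurable_const, fun _ => le_rfl, by simp, ?_⟩
    have : ∀ i ∈ S, ∀ᵐ ω ∂μ, ξ i ω = 0 := fun i hi =>
      (hsub i hi).ae_eq_zero (hmeas i hi) (hscale i hi)
    filter_upwards [(Finset.eventually_all S).2 this] with ω hω i hi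
    rw [hω i hi]; simp
  -- The weighted sum dominates each of its terms, and `x + 1 ≤ exp x` extracts the exponent. The
  -- factor 2 in `2 * σ` puts it strictly beyond every scale.
  · refine ⟨fun ω => ∑ i ∈ S, Real.exp (-L i) * Real.exp (ξ i ω ^ 2 / (2 * σ) ^ 2), ?_,
      fun ω => by positivity, ?_, Filter.Eventually.of_forall fun ω i hi => ?_⟩
    · refine Finset.aemeasurable_fun_sum _ fun i hi => ?_
      exact (Real.measurable_exp.comp_aemeasurable
        (((hmeas i hi).pow_const 2).div_const _)).const_mul _
    · calc ∫⁻ ω, ENNReal.ofReal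
            (∑ i ∈ S, Real.exp (-L i) * Real.exp (ξ i ω ^ 2 / (2 * σ) ^ 2)) ∂μ
          = ∑ i ∈ S, ENNReal.ofReal (Real.exp (-L i)) *
              ∫⁻ ω, ENNReal.ofReal (Real.exp (ξ i ω ^ 2 / (2 * σ) ^ 2)) ∂μ := by
            simp_rw [ENNReal.ofReal_sum_of_nonneg
              (fun i _ => mul_nonneg (Real.exp_pos _).le (Real.exp_pos _).le),
              ENNReal.ofReal_mul (Real.exp_pos _).le]
            rw [lintegral_finsetSum' _ fun i hi => ?_]
            · simp_rw [lintegral_const_mul' _ _ ENNReal.ofReal_ne_top]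
            · exact ((Real.measurable_exp.comp_aemeasurable
                (((hmeas i hi).pow_const 2).div_const _)).ennreal_ofReal).const_mul _
        _ ≤ ∑ i ∈ S, ENNReal.ofReal (Real.exp (-L i)) * 2 := by
            refine Finset.sum_le_sum fun i hi => ?_
            gcongr
            exact (hsub i hi).lintegral_exp_le (hmeas i hi)
              ((hscale i hi).trans_lt (by linarith))
        _ ≤ _ := by
            rw [← Finset.sum_mul, ← ENNReal.ofReal_sum_of_nonneg fun i _ => (Real.exp_pos _).le]
            gcongr
    · have h1 : Real.exp (-L i) * Real.exp (ξ i ω ^ 2 / (2 * σ) ^ 2) ≤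
          ∑ i ∈ S, Real.exp (-L i) * Real.exp (ξ i ω ^ 2 / (2 * σ) ^ 2) :=
        Finset.single_le_sum (f := fun i => Real.exp (-L i) * Real.exp (ξ i ω ^ 2 / (2 * σ) ^ 2))
          (fun i _ => by positivity) hi
      rw [← Real.exp_add] at h1
      have h2 := (Real.add_one_le_exp _).trans h1
      have h3 : ξ i ω ^ 2 / (2 * σ) ^ 2 ≤ L i +
          ∑ i ∈ S, Real.exp (-L i) * Real.exp (ξ i ω ^ 2 / (2 * σ) ^ 2) := by linarith
      rw [div_le_iff₀ (by positivity)] at h3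
      linarith

/-! ### Combinatorial cost of choosing a support -/

noncomputable section

/-- The logarithmic cost `j log (e p / j)` of selecting `j` out of `p` items. -/
def selectionCost (p j : ℕ) : ℝ := (j : ℝ) * Real.log (Real.exp 1 * (p : ℝ) / (j : ℝ))

theorem le_selectionCost {p j : ℕ} (hj : j ≤ p) : (j : ℝ) ≤ selectionCost p j := by
  rcases Nat.eq_zero_or_pos j with rfl | h0
  · simp [selectionCost]
  · have hj0 : (0 : ℝ) < j := by exact_mod_cast h0
    have hjp : (j : ℝ) ≤ p := by exact_mod_cast hj
    have hp0 : (0 : ℝ) < p := hj0.trans_le hjp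
    have : 1 ≤ Real.log (Real.exp 1 * (p : ℝ) / (j : ℝ)) := by
      rw [Real.le_log_iff_exp_le (by positivity), le_div_iff₀ hj0]
      gcongr
    calc (j : ℝ) = j * 1 := (mul_one _).symm
      _ ≤ _ := by unfold selectionCost; gcongr

/-- The right side is `(e p / j) ^ j`, and `j ^ j / j! ≤ e ^ j` compares it with `p ^ j / j!`. -/
theorem choose_le_exp_selectionCost {p j : ℕ} (hj : j ≤ p) :
    (p.choose j : ℝ) ≤ Real.exp (selectionCost p j) := by
  rcases Nat.eq_zero_or_pos j with rfl | h0
  · simp [selectionCost]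
  · have hj0 : (0 : ℝ) < j := by exact_mod_cast h0
    have hp0 : (0 : ℝ) < p := by exact_mod_cast h0.trans_le hj
    have h1 : Real.exp (selectionCost p j) = (Real.exp 1 * p / j) ^ j := by
      rw [selectionCost, Real.exp_nat_mul, Real.exp_log (by positivity)]
    have h2 := Real.pow_div_factorial_le_exp (j : ℝ) hj0.le j
    have h3 : (Real.exp 1) ^ j = Real.exp j := by rw [← Real.exp_nat_mul, mul_one]
    have hf : (0 : ℝ) < j.factorial := by positivity
    rw [h1, div_pow, mul_pow, h3]
    refine (Nat.choose_le_pow_div j p).trans ?_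
    rw [div_le_iff₀ hf] at h2
    rw [div_le_div_iff₀ hf (by positivity)]
    nlinarith [pow_pos hp0 j]

theorem sum_range_exp_neg_le (N : ℕ) : ∑ k ∈ Finset.range N, Real.exp (-(k : ℝ)) ≤ 2 := by
  have hle : Real.exp (-1) ≤ 1 / 2 := by
    rw [Real.exp_neg, one_div]
    refine inv_anti₀ (by norm_num) ?_
    linarith [Real.add_one_le_exp 1]
  calc ∑ k ∈ Finset.range N, Real.exp (-(k : ℝ))
      ≤ ∑ k ∈ Finset.range N, (1 / 2 : ℝ) ^ k := by
        refine Finset.sum_le_sum fun k _ => ?_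
        have : Real.exp (-(k : ℝ)) = Real.exp (-1) ^ k := by
          rw [← Real.exp_nat_mul, mul_neg_one]
        rw [this]
        exact pow_le_pow_left₀ (Real.exp_pos _).le hle k
    _ ≤ 2 := sum_geometric_two_le N

/-- One copy of the cost pays for the number of supports of a given size; the other is at least that
size and leaves a geometric series. -/
theorem sum_exp_neg_selectionCost_le (p : ℕ) :
    ∑ J : Finset (Fin p), Real.exp (-(2 * selectionCost p J.card)) ≤ 2 := by
  rw [← Finset.powerset_univ,
    Finset.sum_powerset_apply_card fun j => Real.exp (-(2 * selectionCost p j)), Finset.card_univ,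
    Fintype.card_fin]
  refine (Finset.sum_le_sum fun j hj => ?_).trans (sum_range_exp_neg_le (p + 1))
  have hjp : j ≤ p := Nat.lt_succ_iff.1 (Finset.mem_range.1 hj)
  rw [nsmul_eq_mul]
  calc (p.choose j : ℝ) * Real.exp (-(2 * selectionCost p j))
      ≤ Real.exp (selectionCost p j) * Real.exp (-(2 * selectionCost p j)) := by
        gcongr
        exact choose_le_exp_selectionCost hjp
    _ = Real.exp (-selectionCost p j) := by rw [← Real.exp_add]; ring_nf
    _ ≤ _ := Real.exp_le_exp.2 (neg_le_neg (le_selectionCost hjp))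

/-- The dimension count of `d × m` matrices of rank `k` is dominated by the rank penalty. -/
theorem add_mul_le_two_mul {a m r k : ℝ} (hk0 : 0 ≤ k) (hka : k ≤ a) (hkr : k ≤ r) (hrm : r ≤ m) :
    (a + m) * k ≤ 2 * ((a + m - r) * r) := by
  rcases le_total r a with h | h
  -- Here `2 * r ≤ a + m`, so `a + m - r` is at least half of `a + m`.
  · nlinarith [mul_nonneg (sub_nonneg.2 hkr) (by linarith : 0 ≤ a + m),
      mul_nonneg (hk0.trans hkr) (by linarith : 0 ≤ a + m - 2 * r)]
  -- Here `(r - a) * (m - r) ≥ 0` gives `(a + m - r) * r ≥ a * m`, while `k ≤ a ≤ m` gives `(a + m)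
  -- * k ≤ 2 * a * m`.
  · nlinarith [mul_nonneg (sub_nonneg.2 h) (sub_nonneg.2 hrm),
      mul_nonneg (sub_nonneg.2 hka) (by linarith : 0 ≤ a + m),
      mul_nonneg (hk0.trans hka) (by linarith : 0 ≤ m - a)]

/-! ### Union bound over residual classes -/

section Classes

open Module

variable {H : Type*} [NormedAddCommGroup H] [InnerProductSpace ℝ H]

/-- The dimension of the span of a family of vectors. -/
def familyRank {m : ℕ} (M : PiLp 2 fun _ : Fin m => H) : ℕ :=
  finrank ℝ (Submodule.span ℝ (Set.range fun j => M j))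

theorem familyRank_le_card {m : ℕ} (M : PiLp 2 fun _ : Fin m => H) : familyRank M ≤ m := by
  refine (finrank_range_le_card (fun j => M j)).trans_eq (Fintype.card_fin m)

/-- A linear map applied to each member of a family of vectors. -/
def mapFamily {m : ℕ} (P : H →ₗ[ℝ] H) (M : PiLp 2 fun _ : Fin m => H) :
    PiLp 2 fun _ : Fin m => H :=
  WithLp.toLp 2 fun j => P (M j)

theorem mapFamily_add {m : ℕ} (P : H →ₗ[ℝ] H) (M N : PiLp 2 fun _ : Fin m => H) :
    mapFamily P (M + N) = mapFamily P M + mapFamily P N := by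
  ext1 j
  exact map_add P (M j) (N j)

variable [FiniteDimensional ℝ H]

theorem familyRank_le_finrank {m : ℕ} {M : PiLp 2 fun _ : Fin m => H} {U : Submodule ℝ H}
    (h : ∀ j, M j ∈ U) : familyRank M ≤ finrank ℝ U :=
  Submodule.finrank_mono (Submodule.span_le.2 (by rintro _ ⟨j, rfl⟩; exact h j))

theorem familyRank_add_le {m : ℕ} (M N : PiLp 2 fun _ : Fin m => H) :
    familyRank (M + N) ≤ familyRank M + familyRank N := by
  refine (Submodule.finrank_mono (Submodule.span_le.2 ?_)).trans
    (Submodule.finrank_add_le_finrank_add_finrank _ _)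
  rintro _ ⟨j, rfl⟩
  exact Submodule.add_mem _
    (Submodule.mem_sup_left (Submodule.subset_span ⟨j, rfl⟩))
    (Submodule.mem_sup_right (Submodule.subset_span ⟨j, rfl⟩))

theorem familyRank_mapFamily_le {m : ℕ} (P : H →ₗ[ℝ] H) (M : PiLp 2 fun _ : Fin m => H) :
    familyRank (mapFamily P M) ≤ familyRank M := by
  have : Submodule.span ℝ (Set.range fun j => mapFamily P M j) =
      (Submodule.span ℝ (Set.range fun j => M j)).map P := by
    rw [Submodule.map_span, ← Set.range_comp]
    rfl
  unfold familyRank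
  rw [this]
  exact Submodule.finrank_map_le _ _

/-- The projection onto the orthogonal complement of `U`. -/
def residualMap (U : Submodule ℝ H) : H →ₗ[ℝ] H := Uᗮ.starProjection.toLinearMap

/-- The part of `V` orthogonal to `U`. -/
def residualSpace (U V : Submodule ℝ H) : Submodule ℝ H := V.map (residualMap U)

theorem finrank_residualSpace_le (U V : Submodule ℝ H) :
    finrank ℝ (residualSpace U V) ≤ finrank ℝ V := Submodule.finrank_map_le _ _

theorem residualSpace_bot (V : Submodule ℝ H) : residualSpace ⊥ V = V := by
  have : residualMap (⊥ : Submodule ℝ H) = LinearMap.id := by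
    ext x
    exact Submodule.starProjection_eq_self_iff.2 (by simp)
  rw [residualSpace, this, Submodule.map_id]

/-- By Pythagoras, the quadratic terms of the two separate noise bounds add up without loss. -/
theorem norm_sq_eq_add_residual {m : ℕ} (U : Submodule ℝ H) (M : PiLp 2 fun _ : Fin m => H) :
    ‖M‖ ^ 2 = ‖mapFamily U.starProjection.toLinearMap M‖ ^ 2 +
      ‖mapFamily (residualMap U) M‖ ^ 2 := by
  simp only [PiLp.norm_sq_eq_of_L2]
  rw [← Finset.sum_add_distrib]
  refine Finset.sum_congr rfl fun j _ => ?_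
  exact U.norm_sq_eq_add_norm_sq_starProjection (M j)

theorem add_residual_eq {m : ℕ} (U : Submodule ℝ H) (M : PiLp 2 fun _ : Fin m => H) :
    mapFamily U.starProjection.toLinearMap M + mapFamily (residualMap U) M = M := by
  ext1 j
  exact U.starProjection_add_starProjection_orthogonal (M j)

theorem familyRank_neg_le {m : ℕ} (M : PiLp 2 fun _ : Fin m => H) :
    familyRank (-M) ≤ familyRank M := by
  have : -M = mapFamily (-LinearMap.id) M := by ext1 j; rfl
  rw [this]
  exact familyRank_mapFamily_le _ _

/-- The offset attached to the families of `m` vectors of rank `k` in the residual space of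
`S J₁` and `S J₂`. -/
def classCost {p : ℕ} (S : Finset (Fin p) → Submodule ℝ H) (m : ℕ) (J₁ J₂ : Finset (Fin p))
    (k : ℕ) : ℝ :=
  Real.log 5 * ((k * (finrank ℝ (residualSpace (S J₁) (S J₂)) + m) : ℕ) : ℝ) +
    2 * selectionCost p J₁.card + 2 * selectionCost p J₂.card + k

theorem exists_class_nets {p : ℕ} (S : Finset (Fin p) → Submodule ℝ H) (m : ℕ) :
    ∃ T : Finset (Fin p) × Finset (Fin p) × ℕ → Finset (PiLp 2 fun _ : Fin m => H),
      (∀ c, ∀ t ∈ T c, ‖t‖ ≤ 1) ∧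
      (∀ J₁ J₂ k (f : (PiLp 2 fun _ : Fin m => H) →ₗ[ℝ] ℝ) (c : ℝ),
        (∀ t ∈ T (J₁, J₂, k), f t ≤ c) → ∀ M : PiLp 2 fun _ : Fin m => H,
          (∀ j, M j ∈ residualSpace (S J₁) (S J₂)) → familyRank M = k → f M ≤ 4 * c * ‖M‖) ∧
      ∑ x ∈ (Finset.univ ×ˢ Finset.univ ×ˢ Finset.range (m + 1)).sigma T,
        Real.exp (-classCost S m x.1.1 x.1.2.1 x.1.2.2) ≤ 8 := by
  choose T hcard hnorm hT using fun c : Finset (Fin p) × Finset (Fin p) × ℕ =>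
    exists_lowRank_net (residualSpace (S c.1) (S c.2.1)) m c.2.2
  refine ⟨T, hnorm, fun J₁ J₂ k f c hf M hM hk => hT (J₁, J₂, k) f c hf M hM hk, ?_⟩
  set I : Finset (Finset (Fin p) × Finset (Fin p) × ℕ) :=
    Finset.univ ×ˢ Finset.univ ×ˢ Finset.range (m + 1)
  rw [Finset.sum_sigma]
  calc ∑ c ∈ I,
        ∑ _t ∈ T c, Real.exp (-classCost S m c.1 c.2.1 c.2.2)
      ≤ ∑ c ∈ I,
        Real.exp (-(2 * selectionCost p c.1.card)) *
          (Real.exp (-(2 * selectionCost p c.2.1.card)) * Real.exp (-(c.2.2 : ℝ))) := by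
        refine Finset.sum_le_sum fun c _ => ?_
        rw [Finset.sum_const, nsmul_eq_mul]
        set N := c.2.2 * (finrank ℝ (residualSpace (S c.1) (S c.2.1)) + m) with hN
        have h5 : ((T c).card : ℝ) ≤ Real.exp (Real.log 5 * N) := by
          rw [mul_comm, Real.exp_nat_mul, Real.exp_log (by norm_num)]
          exact_mod_cast hcard c
        calc _ ≤ Real.exp (Real.log 5 * N) * Real.exp (-classCost S m c.1 c.2.1 c.2.2) := by gcongr
          _ = _ := by
            rw [← Real.exp_add, ← Real.exp_add, ← Real.exp_add, classCost]
            congr 1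
            ring
    _ = (∑ J : Finset (Fin p), Real.exp (-(2 * selectionCost p J.card))) *
        ((∑ J : Finset (Fin p), Real.exp (-(2 * selectionCost p J.card))) *
          ∑ k ∈ Finset.range (m + 1), Real.exp (-(k : ℝ))) := by
        rw [Finset.sum_product, Finset.sum_mul]
        refine Finset.sum_congr rfl fun J _ => ?_
        rw [Finset.sum_product, Finset.sum_mul_sum, Finset.mul_sum]
        simp_rw [Finset.mul_sum]
    _ ≤ 2 * (2 * 2) := by
        gcongr
        · exact sum_exp_neg_selectionCost_le p
        · exact sum_exp_neg_selectionCost_le p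
        · exact sum_range_exp_neg_le _
    _ = 8 := by norm_num

/-- The complexity of a family of rank `k` in the space `S J`. -/
def familyCost {p m : ℕ} (S : Finset (Fin p) → Submodule ℝ H) (J : Finset (Fin p))
    (M : PiLp 2 fun _ : Fin m => H) : ℝ :=
  familyRank M * (finrank ℝ (S J) + m) + selectionCost p J.card

/-- The 3 is `log 5 ≤ 2` plus 1 for the summand `k`, which is at most `k * (dim + m)`: a positive `k
≤ m` forces `m ≥ 1`. -/
theorem classCost_le {p m : ℕ} (S : Finset (Fin p) → Submodule ℝ H) (J₁ J₂ : Finset (Fin p))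
    {k : ℕ} (hk : k ≤ m) {K d : ℝ} (hkK : (k : ℝ) ≤ K)
    (hd : (finrank ℝ (residualSpace (S J₁) (S J₂)) : ℝ) ≤ d) :
    classCost S m J₁ J₂ k ≤
      3 * (K * (d + m)) + 2 * selectionCost p J₁.card + 2 * selectionCost p J₂.card := by
  have h5 : Real.log 5 ≤ 2 := by
    rw [Real.log_le_iff_le_exp (by norm_num), show (2 : ℝ) = 1 + 1 by norm_num, Real.exp_add]
    nlinarith [Real.exp_one_gt_d9]
  set N := k * (finrank ℝ (residualSpace (S J₁) (S J₂)) + m) with hN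
  have hkN : k ≤ N := by
    rcases Nat.eq_zero_or_pos k with rfl | h0
    · simp
    · exact Nat.le_mul_of_pos_right _ (by omega)
  have hkN' : (k : ℝ) ≤ N := by exact_mod_cast hkN
  have hNle : (N : ℝ) ≤ K * (d + m) := by
    rw [hN]
    push_cast
    gcongr
    exact (Nat.cast_nonneg k).trans hkK
  have h0 : (0 : ℝ) ≤ N := Nat.cast_nonneg N
  unfold classCost
  nlinarith

/-- The projection onto `S J` may have rank up to the sum of both ranks, but lives in the smaller
dimension; the residual may have the larger dimension, but only the rank of `N`, as `M` is
annihilated. -/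
theorem add_family_le_of_finrank_le {p m : ℕ} {S : Finset (Fin p) → Submodule ℝ H} (hS : S ∅ = ⊥)
    {f : (PiLp 2 fun _ : Fin m => H) →ₗ[ℝ] ℝ} {a b W : ℝ} (hb : 0 ≤ b)
    (hf : ∀ J₁ J₂ (M : PiLp 2 fun _ : Fin m => H),
      (∀ j, M j ∈ residualSpace (S J₁) (S J₂)) →
        f M ≤ a * ‖M‖ ^ 2 + b * (classCost S m J₁ J₂ (familyRank M) + W))
    {J J' : Finset (Fin p)} {M N : PiLp 2 fun _ : Fin m => H} (hM : ∀ j, M j ∈ S J)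
    (hN : ∀ j, N j ∈ S J') (hdim : finrank ℝ (S J) ≤ finrank ℝ (S J')) :
    f (M + N) ≤ a * ‖M + N‖ ^ 2 + b * (6 * (familyCost S J M + familyCost S J' N) + 2 * W) := by
  set P₁ := mapFamily (S J).starProjection.toLinearMap (M + N) with hP₁
  set P₂ := mapFamily (residualMap (S J)) (M + N) with hP₂
  have hP₂N : P₂ = mapFamily (residualMap (S J)) N := by
    have : mapFamily (residualMap (S J)) M = 0 := by
      ext1 j
      exact (Submodule.starProjection_apply_eq_zero_iff _).2
        (Submodule.le_orthogonal_orthogonal _ (hM j))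
    rw [hP₂, mapFamily_add, this, zero_add]
  -- With first index `∅` the residual space is `S J` itself and the empty support costs nothing.
  have h₁ := hf ∅ J P₁ fun j => by
    rw [hS, residualSpace_bot]
    exact Submodule.starProjection_apply_mem _ _
  have h₂ := hf J J' P₂ fun j => by
    rw [hP₂N]
    exact Submodule.mem_map_of_mem (hN j)
  have hsplit : f (M + N) = f P₁ + f P₂ := by rw [← map_add, hP₁, hP₂, add_residual_eq]
  have hnorm : ‖M + N‖ ^ 2 = ‖P₁‖ ^ 2 + ‖P₂‖ ^ 2 := norm_sq_eq_add_residual (S J) (M + N)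
  have hr₁ : (familyRank P₁ : ℝ) ≤ familyRank M + familyRank N := by
    exact_mod_cast (familyRank_mapFamily_le _ _).trans (familyRank_add_le M N)
  have hr₂ : (familyRank P₂ : ℝ) ≤ familyRank N := by
    rw [hP₂N]
    exact_mod_cast familyRank_mapFamily_le _ _
  have hd₁ : (finrank ℝ (residualSpace (S ∅) (S J)) : ℝ) ≤ finrank ℝ (S J) := by
    exact_mod_cast finrank_residualSpace_le _ _
  have hd₂ : (finrank ℝ (residualSpace (S J) (S J')) : ℝ) ≤ finrank ℝ (S J') := by
    exact_mod_cast finrank_residualSpace_le _ _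
  have hc₁ := classCost_le (m := m) S ∅ J (familyRank_le_card P₁) hr₁ hd₁
  have hc₂ := classCost_le (m := m) S J J' (familyRank_le_card P₂) hr₂ hd₂
  have hw₀ : selectionCost p (∅ : Finset (Fin p)).card = 0 := by simp [selectionCost]
  have hw : ∀ J : Finset (Fin p), 0 ≤ selectionCost p J.card := fun J =>
    (Nat.cast_nonneg _).trans (le_selectionCost ((Finset.card_le_univ J).trans_eq (by simp)))
  have hdim' : (finrank ℝ (S J) : ℝ) ≤ finrank ℝ (S J') := by exact_mod_cast hdim
  -- The only mixed term, and the reason for projecting onto the smaller space.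
  have hcross : (familyRank N : ℝ) * (finrank ℝ (S J) + m) ≤
      familyRank N * (finrank ℝ (S J') + m) := by gcongr
  have hpos : (0 : ℝ) ≤ familyRank M * (finrank ℝ (S J) + m) := by positivity
  have hcost : classCost S m ∅ J (familyRank P₁) + classCost S m J J' (familyRank P₂) ≤
      6 * (familyCost S J M + familyCost S J' N) := by
    unfold familyCost
    linarith [hw J, hw J', hcross, hpos]
  have := mul_le_mul_of_nonneg_left hcost hb
  rw [hsplit, hnorm]
  linarith

/-- A functional controlled on all residual classes is controlled on sums of two families. -/
theorem add_family_le {p m : ℕ} {S : Finset (Fin p) → Submodule ℝ H} (hS : S ∅ = ⊥)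
    {f : (PiLp 2 fun _ : Fin m => H) →ₗ[ℝ] ℝ} {a b W : ℝ} (hb : 0 ≤ b)
    (hf : ∀ J₁ J₂ (M : PiLp 2 fun _ : Fin m => H),
      (∀ j, M j ∈ residualSpace (S J₁) (S J₂)) →
        f M ≤ a * ‖M‖ ^ 2 + b * (classCost S m J₁ J₂ (familyRank M) + W))
    {J J' : Finset (Fin p)} {M N : PiLp 2 fun _ : Fin m => H} (hM : ∀ j, M j ∈ S J)
    (hN : ∀ j, N j ∈ S J') :
    f (M + N) ≤ a * ‖M + N‖ ^ 2 + b * (6 * (familyCost S J M + familyCost S J' N) + 2 * W) := by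
  rcases le_total (finrank ℝ (S J)) (finrank ℝ (S J')) with h | h
  · exact add_family_le_of_finrank_le hS hb hf hM hN h
  · rw [add_comm M N, add_comm (familyCost S J M)]
    exact add_family_le_of_finrank_le hS hb hf hN hM h

end Classes

end

/-! ### From matrices to families of columns -/

noncomputable section

/-- The columns of a matrix, as a family of Euclidean vectors. -/
def columnFamily {n m : ℕ} : Matrix (Fin n) (Fin m) ℝ →ₗ[ℝ]
    PiLp 2 (fun _ : Fin m => EuclideanSpace ℝ (Fin n)) where
  toFun M := WithLp.toLp 2 fun j => WithLp.toLp 2 fun i => M i j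
  map_add' _ _ := rfl
  map_smul' _ _ := rfl

theorem columnFamily_apply {n m : ℕ} (M : Matrix (Fin n) (Fin m) ℝ) (j : Fin m) (i : Fin n) :
    columnFamily M j i = M i j := rfl

theorem norm_columnFamily_sq {n m : ℕ} (M : Matrix (Fin n) (Fin m) ℝ) :
    ‖columnFamily M‖ ^ 2 = ‖M‖ ^ 2 := by
  have h : ‖M‖ ^ 2 = ∑ i, ∑ j, ‖M i j‖ ^ 2 := by
    rw [Matrix.frobenius_norm_def, ← Real.sqrt_eq_rpow, Real.sq_sqrt]
    · norm_cast
    · positivity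
  rw [h, Finset.sum_comm, PiLp.norm_sq_eq_of_L2]
  exact Finset.sum_congr rfl fun j _ => EuclideanSpace.norm_sq_eq _

/-- The entries of a family of Euclidean vectors, as a single vector. -/
def flattenFamily {n m : ℕ} (t : PiLp 2 fun _ : Fin m => EuclideanSpace ℝ (Fin n)) :
    EuclideanSpace ℝ (Fin m × Fin n) :=
  WithLp.toLp 2 fun x => t x.1 x.2

theorem norm_flattenFamily {n m : ℕ} (t : PiLp 2 fun _ : Fin m => EuclideanSpace ℝ (Fin n)) :
    ‖flattenFamily t‖ = ‖t‖ := by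
  rw [← sq_eq_sq₀ (norm_nonneg _) (norm_nonneg _), EuclideanSpace.norm_sq_eq,
    PiLp.norm_sq_eq_of_L2, Fintype.sum_prod_type]
  exact Finset.sum_congr rfl fun j _ => (EuclideanSpace.norm_sq_eq (t j)).symm

theorem inner_vec_flattenFamily {n m : ℕ} (E : Matrix (Fin n) (Fin m) ℝ)
    (t : PiLp 2 fun _ : Fin m => EuclideanSpace ℝ (Fin n)) :
    inner ℝ (WithLp.toLp 2 E.vec) (flattenFamily t) = inner ℝ (columnFamily E) t := by
  rw [PiLp.inner_apply, PiLp.inner_apply, Fintype.sum_prod_type]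
  exact Finset.sum_congr rfl fun j _ => (PiLp.inner_apply (columnFamily E j) (t j)).symm

open Module

/-- The span of the columns of `X` with index in `J`. -/
def columnSpan {n p : ℕ} (X : Matrix (Fin n) (Fin p) ℝ) (J : Finset (Fin p)) :
    Submodule ℝ (EuclideanSpace ℝ (Fin n)) :=
  Submodule.span ℝ (Set.range fun i : J => WithLp.toLp 2 (X.col i))

theorem columnSpan_empty {n p : ℕ} (X : Matrix (Fin n) (Fin p) ℝ) : columnSpan X ∅ = ⊥ := by
  simp [columnSpan]

theorem finrank_columnSpan_le_card {n p : ℕ} (X : Matrix (Fin n) (Fin p) ℝ)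
    (J : Finset (Fin p)) : finrank ℝ (columnSpan X J) ≤ J.card :=
  (finrank_range_le_card _).trans_eq (Fintype.card_coe J)

theorem familyRank_columnFamily {n m : ℕ} (M : Matrix (Fin n) (Fin m) ℝ) :
    familyRank (columnFamily M) = M.rank := by
  let e := (WithLp.linearEquiv 2 ℝ (Fin n → ℝ)).symm
  have : Submodule.span ℝ (Set.range fun j => columnFamily M j) =
      (Submodule.span ℝ (Set.range M.col)).map e.toLinearMap := by
    rw [Submodule.map_span, ← Set.range_comp]
    rfl
  rw [familyRank, this, M.rank_eq_finrank_span_cols]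
  exact LinearEquiv.finrank_map_eq e _

theorem finrank_columnSpan_le_rank {n p : ℕ} (X : Matrix (Fin n) (Fin p) ℝ)
    (J : Finset (Fin p)) : finrank ℝ (columnSpan X J) ≤ X.rank := by
  rw [← familyRank_columnFamily]
  refine Submodule.finrank_mono (Submodule.span_mono ?_)
  rintro _ ⟨i, rfl⟩
  exact ⟨i, rfl⟩

theorem columnFamily_mul_mem {n p m : ℕ} (X : Matrix (Fin n) (Fin p) ℝ)
    (B : Matrix (Fin p) (Fin m) ℝ) (j : Fin m) :
    columnFamily (X * B) j ∈ columnSpan X (rowSupport B) := by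
  have : columnFamily (X * B) j = ∑ i, B i j • WithLp.toLp 2 (X.col i) := by
    ext a
    simp [columnFamily_apply, Matrix.mul_apply, mul_comm]
  rw [this]
  refine Submodule.sum_mem _ fun i _ => ?_
  by_cases hi : i ∈ rowSupport B
  · exact Submodule.smul_mem _ _ (Submodule.subset_span ⟨⟨i, hi⟩, rfl⟩)
  · have hrow : B.row i = 0 := by simpa [rowSupport] using hi
    have hij : B i j = 0 := congrFun hrow j
    rw [hij, zero_smul]
    exact Submodule.zero_mem _

/-- The rank of `X * B` is at most both `q ∧ J(B)` and `r(B)`, so `add_mul_le_two_mul` applies even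
when `r(B)` exceeds `q`. -/
theorem familyCost_le_complexityPo {n p m : ℕ} (X : Matrix (Fin n) (Fin p) ℝ)
    (B : Matrix (Fin p) (Fin m) ℝ) :
    familyCost (columnSpan X) (rowSupport B) (columnFamily (X * B)) ≤ 2 * complexityPo X B := by
  set a : ℝ := min (X.rank : ℝ) ((rowSupport B).card : ℝ) with ha
  set k := familyRank (columnFamily (X * B)) with hk
  have hd : (finrank ℝ (columnSpan X (rowSupport B)) : ℝ) ≤ a :=
    le_min (by exact_mod_cast finrank_columnSpan_le_rank X _)
      (by exact_mod_cast finrank_columnSpan_le_card X _)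
  have hka : (k : ℝ) ≤ a := le_trans
    (by exact_mod_cast familyRank_le_finrank (columnFamily_mul_mem X B)) hd
  have hkr : (k : ℝ) ≤ B.rank := by
    rw [hk, familyRank_columnFamily]
    exact_mod_cast Matrix.rank_mul_le_right X B
  have hrm : (B.rank : ℝ) ≤ m := by exact_mod_cast B.rank_le_width
  have h1 := add_mul_le_two_mul (Nat.cast_nonneg k) hka hkr hrm
  have h2 : (k : ℝ) * (finrank ℝ (columnSpan X (rowSupport B)) + m) ≤ k * (a + m) := by gcongr
  have hw : 0 ≤ selectionCost p (rowSupport B).card :=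
    (Nat.cast_nonneg _).trans
      (le_selectionCost ((Finset.card_le_univ _).trans_eq (by simp)))
  change k * (finrank ℝ (columnSpan X (rowSupport B)) + m) + selectionCost p (rowSupport B).card ≤
    2 * ((a + m - B.rank) * B.rank + selectionCost p (rowSupport B).card)
  linarith

/-- A nonzero row already costs at least 1 in the selection term. This lets a multiple of `σ²` be
charged to the oracle risk. -/
theorem one_le_complexityPo {n p m : ℕ} (X : Matrix (Fin n) (Fin p) ℝ)
    {B : Matrix (Fin p) (Fin m) ℝ} (hB : B ≠ 0) : 1 ≤ complexityPo X B := by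
  have hcard : 1 ≤ (rowSupport B).card := by
    rw [Nat.one_le_iff_ne_zero, Finset.card_ne_zero]
    by_contra hempty
    refine hB ?_
    ext i j
    have hi : i ∉ rowSupport B := by simp [Finset.not_nonempty_iff_eq_empty.1 hempty]
    have hrow : B.row i = 0 := by simpa [rowSupport] using hi
    exact congrFun hrow j
  have h1 : (1 : ℝ) ≤ selectionCost p (rowSupport B).card :=
    le_trans (by exact_mod_cast hcard)
      (le_selectionCost ((Finset.card_le_univ _).trans_eq (by simp)))
  have hrm : (B.rank : ℝ) ≤ m := by exact_mod_cast B.rank_le_width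
  have ha : (0 : ℝ) ≤ min (X.rank : ℝ) ((rowSupport B).card : ℝ) := by positivity
  have h2 : 0 ≤ (min (X.rank : ℝ) ((rowSupport B).card : ℝ) + m - B.rank) * B.rank :=
    mul_nonneg (by linarith) (Nat.cast_nonneg _)
  change 1 ≤ _ + selectionCost p (rowSupport B).card
  linarith

end

/-! ### Uniform noise bound and oracle inequality -/

theorem familyCost_neg_le {H : Type*} [NormedAddCommGroup H] [InnerProductSpace ℝ H]
    [FiniteDimensional ℝ H] {p m : ℕ} (S : Finset (Fin p) → Submodule ℝ H) (J : Finset (Fin p))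
    (M : PiLp 2 fun _ : Fin m => H) : familyCost S J (-M) ≤ familyCost S J M := by
  have : (familyRank (-M) : ℝ) ≤ familyRank M := by exact_mod_cast familyRank_neg_le M
  unfold familyCost
  gcongr

/-- Uniform control of the noise on differences `X B - X B'` by their complexities. -/
theorem exists_uniform_noise_bound {n p m : ℕ} (X : Matrix (Fin n) (Fin p) ℝ) {σ : ℝ}
    (hσ : 0 ≤ σ) {Ω : Type*} [MeasurableSpace Ω] {μ : Measure Ω} [IsProbabilityMeasure μ]
    {E : Ω → Matrix (Fin n) (Fin m) ℝ}
    (hE : IsSubGaussianVector (fun ω => WithLp.toLp 2 (E ω).vec) σ μ) :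
    ∃ W : Ω → ℝ, AEMeasurable W μ ∧ (∀ ω, 0 ≤ W ω) ∧
      ∫⁻ ω, ENNReal.ofReal (W ω) ∂μ ≤ 16 ∧
      ∀ᵐ ω ∂μ, ∀ B B' : Matrix (Fin p) (Fin m) ℝ,
        inner ℝ (columnFamily (E ω)) (columnFamily (X * B - X * B')) ≤
          1 / 8 * ‖X * B - X * B'‖ ^ 2 +
            128 * σ ^ 2 * (12 * (complexityPo X B + complexityPo X B') + 2 * W ω) := by
  obtain ⟨T, hTnorm, hT, hsum⟩ := exists_class_nets (columnSpan X) m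
  have hinner : ∀ (t : PiLp 2 fun _ : Fin m => EuclideanSpace ℝ (Fin n)),
      (fun ω => inner ℝ (columnFamily (E ω)) t) =
        fun ω => inner ℝ (WithLp.toLp 2 (E ω).vec) (flattenFamily t) := fun t =>
    funext fun ω => (inner_vec_flattenFamily (E ω) t).symm
  obtain ⟨W, hWmeas, hW0, hWint, hW⟩ := exists_uniform_sq_bound (μ := μ)
    ((Finset.univ ×ˢ Finset.univ ×ˢ Finset.range (m + 1)).sigma T)
    (fun x ω => inner ℝ (columnFamily (E ω)) x.2)
    (fun x => classCost (columnSpan X) m x.1.1 x.1.2.1 x.1.2.2) hσ hsum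
    (fun x _ => by rw [hinner]; exact hE.isSubGaussian _)
    (fun x _ => by rw [hinner]; exact hE.aemeasurable.inner aemeasurable_const)
    (fun x hx => by
      rw [hinner]
      refine (hE.scale_le _).trans (mul_le_of_le_one_right hσ ?_)
      rw [norm_flattenFamily]
      exact hTnorm _ _ (Finset.mem_sigma.1 hx).2)
  refine ⟨W, hWmeas, hW0, hWint.trans_eq ?_, ?_⟩
  · rw [← ENNReal.ofReal_ofNat 2, ← ENNReal.ofReal_mul (by norm_num)]
    norm_num
  filter_upwards [hW] with ω hω B B'
  have hclass : ∀ J₁ J₂ (M : PiLp 2 fun _ : Fin m => EuclideanSpace ℝ (Fin n)),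
      (∀ j, M j ∈ residualSpace (columnSpan X J₁) (columnSpan X J₂)) →
      (innerₛₗ ℝ (columnFamily (E ω))) M ≤ 1 / 8 * ‖M‖ ^ 2 +
        128 * σ ^ 2 * (classCost (columnSpan X) m J₁ J₂ (familyRank M) + W ω) := by
    intro J₁ J₂ M hM
    set v := classCost (columnSpan X) m J₁ J₂ (familyRank M) + W ω with hv
    have hlt : familyRank M < m + 1 := Nat.lt_succ_of_le (familyRank_le_card M)
    have hnet : ∀ t ∈ T (J₁, J₂, familyRank M),
        (innerₛₗ ℝ (columnFamily (E ω))) t ≤ Real.sqrt (4 * σ ^ 2 * v) := fun t ht =>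
      Real.le_sqrt_of_sq_le (hω ⟨(J₁, J₂, familyRank M), t⟩ (by simp [ht, hlt]))
    have h := hT J₁ J₂ (familyRank M) _ _ hnet M hM rfl
    have hv0 : 0 ≤ v := by
      refine add_nonneg ?_ (hW0 ω)
      have hw : ∀ J : Finset (Fin p), 0 ≤ selectionCost p J.card := fun J =>
        (Nat.cast_nonneg _).trans (le_selectionCost ((Finset.card_le_univ J).trans_eq (by simp)))
      have h5 : 0 ≤ Real.log 5 := Real.log_nonneg (by norm_num)
      have := hw J₁
      have := hw J₂
      unfold classCost
      positivity
    have hsq := Real.sq_sqrt (show 0 ≤ 4 * σ ^ 2 * v by positivity)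
    -- With `s = √(4σ²v)`, `4 s ‖M‖ ≤ ‖M‖² / 8 + 32 s²`, and `32 * 4 = 128`.
    nlinarith [sq_nonneg (‖M‖ - 16 * Real.sqrt (4 * σ ^ 2 * v))]
  have h := add_family_le (columnSpan_empty X) (by positivity) hclass
    (columnFamily_mul_mem X B)
    (N := -columnFamily (X * B')) (fun j => Submodule.neg_mem _ (columnFamily_mul_mem X B' j))
  rw [← sub_eq_add_neg, ← map_sub, norm_columnFamily_sq] at h
  refine h.trans ?_
  have h1 := familyCost_le_complexityPo X B
  have h2 := (familyCost_neg_le (columnSpan X) (rowSupport B') (columnFamily (X * B'))).trans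
    (familyCost_le_complexityPo X B')
  refine add_le_add le_rfl (mul_le_mul_of_nonneg_left ?_ (by positivity))
  linarith

/-- The deterministic oracle inequality on an event where the noise is controlled. -/
theorem prediction_error_le {n p m : ℕ} {X : Matrix (Fin n) (Fin p) ℝ}
    {Bstar B B' : Matrix (Fin p) (Fin m) ℝ} {E : Matrix (Fin n) (Fin m) ℝ} {σ A W : ℝ}
    (hA : 1536 ≤ A) (hPB : 0 ≤ complexityPo X B)
    (hnoise : inner ℝ (columnFamily E) (columnFamily (X * B - X * B')) ≤
      1 / 8 * ‖X * B - X * B'‖ ^ 2 +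
        128 * σ ^ 2 * (12 * (complexityPo X B + complexityPo X B') + 2 * W))
    (hmin : predictiveIC X (X * Bstar + E) σ A B ≤ predictiveIC X (X * Bstar + E) σ A B') :
    ‖X * B - X * Bstar‖ ^ 2 ≤ 3 * ‖X * B' - X * Bstar‖ ^ 2 +
      4 * (A + 1536) * (σ ^ 2 * complexityPo X B') + 1024 * (σ ^ 2 * W) := by
  unfold predictiveIC at hmin
  have hexpand : ∀ B : Matrix (Fin p) (Fin m) ℝ, ‖X * Bstar + E - X * B‖ ^ 2 =
      ‖E‖ ^ 2 - 2 * inner ℝ (columnFamily E) (columnFamily (X * B - X * Bstar)) +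
        ‖X * B - X * Bstar‖ ^ 2 := by
    intro B
    have : X * Bstar + E - X * B = E - (X * B - X * Bstar) := by abel
    rw [this, ← norm_columnFamily_sq, ← norm_columnFamily_sq E,
      ← norm_columnFamily_sq (X * B - X * Bstar), map_sub, norm_sub_sq_real]
  rw [hexpand, hexpand] at hmin
  have hdiff : inner ℝ (columnFamily E) (columnFamily (X * B - X * B')) =
      inner ℝ (columnFamily E) (columnFamily (X * B - X * Bstar)) -
        inner ℝ (columnFamily E) (columnFamily (X * B' - X * Bstar)) := by
    rw [← inner_sub_right, ← map_sub, sub_sub_sub_cancel_right]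
  have hnorm : ‖X * B - X * B'‖ ^ 2 ≤
      2 * ‖X * B - X * Bstar‖ ^ 2 + 2 * ‖X * B' - X * Bstar‖ ^ 2 := by
    have h := norm_sub_le (X * B - X * Bstar) (X * B' - X * Bstar)
    rw [sub_sub_sub_cancel_right] at h
    nlinarith [norm_nonneg (X * B - X * B'),
      sq_nonneg (‖X * B - X * Bstar‖ - ‖X * B' - X * Bstar‖)]
  -- `1536 = 128 * 12` is the noise cost of `B`. The quadratic noise term takes a quarter of each
  -- squared error, leaving a quarter for `B`; multiplying by 4 gives the stated constants.
  have hpen : 1536 * (σ ^ 2 * complexityPo X B) ≤ A * (σ ^ 2 * complexityPo X B) := by gcongr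
  linarith

theorem theorem2 :
    ∃ A₀ : ℝ, 0 < A₀ ∧ ∀ A : ℝ, A₀ ≤ A → ∃ C : ℝ, 0 < C ∧
      ∀ (n p m : ℕ) (X : Matrix (Fin n) (Fin p) ℝ) (Bstar : Matrix (Fin p) (Fin m) ℝ)
        (σ : ℝ) (_ : 0 ≤ σ)
        (Ω : Type*) [MeasurableSpace Ω] (μ : Measure Ω) [IsProbabilityMeasure μ]
        (E Y : Ω → Matrix (Fin n) (Fin m) ℝ)
        (_ : IsSubGaussianVector (fun ω => WithLp.toLp 2 (E ω).vec) σ μ)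
        (_ : ∀ i k, ∫ ω, E ω i k ∂μ = 0)
        (_ : ∀ ω, Y ω = X * Bstar + E ω)
        (ι : Type*) (B : ι → Ω → Matrix (Fin p) (Fin m) ℝ)
        (_ : ∀ᵐ ω ∂μ, ∀ l, B l ω ≠ 0)
        (Bhat : Ω → Matrix (Fin p) (Fin m) ℝ)
        (_ : ∀ᵐ ω ∂μ, Bhat ω ∈ Set.range (fun l => B l ω) ∧
          IsMinOn (predictiveIC X (Y ω) σ A) (Set.range (fun l => B l ω)) (Bhat ω)),
        ∫⁻ ω, ENNReal.ofReal (‖X * Bhat ω - X * Bstar‖ ^ 2) ∂μ ≤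
          ENNReal.ofReal C * ⨅ l, ∫⁻ ω,
            ENNReal.ofReal (‖X * B l ω - X * Bstar‖ ^ 2 + σ ^ 2 * complexityPo X (B l ω)) ∂μ := by
  refine ⟨1536, by norm_num, fun A hA => ⟨4 * (A + 1536) + 16384, by linarith, ?_⟩⟩
  intro n p m X Bstar σ hσ Ω _ μ _ E Y hE _ hY ι B hB Bhat hBhat
  obtain ⟨W, hWmeas, hW0, hWint, hW⟩ := exists_uniform_noise_bound X hσ hE
  rw [ENNReal.mul_iInf_of_ne (by simp; linarith) ENNReal.ofReal_ne_top]
  refine le_iInf fun l => ?_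
  set f : Ω → ℝ≥0∞ := fun ω =>
    ENNReal.ofReal (‖X * B l ω - X * Bstar‖ ^ 2 + σ ^ 2 * complexityPo X (B l ω)) with hf
  have hpath : ∀ᵐ ω ∂μ, ENNReal.ofReal (‖X * Bhat ω - X * Bstar‖ ^ 2) ≤
      ENNReal.ofReal (4 * (A + 1536)) * f ω + ENNReal.ofReal (1024 * σ ^ 2 * W ω) := by
    filter_upwards [hB, hBhat, hW] with ω hBω hmin hWω
    obtain ⟨⟨k, hk⟩, hmin⟩ := hmin
    have hPhat : 0 ≤ complexityPo X (Bhat ω) := by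
      rw [← hk]
      exact zero_le_one.trans (one_le_complexityPo X (hBω k))
    have hcomp := hmin (Set.mem_range_self l)
    rw [Set.mem_ofPred_eq, hY ω] at hcomp
    have h := prediction_error_le hA hPhat (hWω (Bhat ω) (B l ω)) hcomp
    have hP : 0 ≤ σ ^ 2 * complexityPo X (B l ω) :=
      mul_nonneg (sq_nonneg σ) (zero_le_one.trans (one_le_complexityPo X (hBω l)))
    have hWpos := hW0 ω
    rw [hf, ← ENNReal.ofReal_mul (by linarith), ← ENNReal.ofReal_add
      (mul_nonneg (by linarith) (add_nonneg (sq_nonneg _) hP)) (by positivity)]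
    refine ENNReal.ofReal_le_ofReal (h.trans ?_)
    nlinarith [sq_nonneg ‖X * B l ω - X * Bstar‖]
  -- Since `1024 * E W ≤ 1024 * 16 = 16384`, this bounds the noise remainder by the risk of the
  -- competitor.
  have hσf : ENNReal.ofReal (σ ^ 2) ≤ ∫⁻ ω, f ω ∂μ := by
    calc ENNReal.ofReal (σ ^ 2) = ∫⁻ _, ENNReal.ofReal (σ ^ 2) ∂μ := by simp
      _ ≤ _ := by
        refine lintegral_mono_ae ?_
        filter_upwards [hB] with ω hBω
        refine ENNReal.ofReal_le_ofReal ?_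
        have := mul_le_mul_of_nonneg_left (one_le_complexityPo X (hBω l)) (sq_nonneg σ)
        nlinarith [sq_nonneg ‖X * B l ω - X * Bstar‖]
  calc ∫⁻ ω, ENNReal.ofReal (‖X * Bhat ω - X * Bstar‖ ^ 2) ∂μ
      ≤ ∫⁻ ω, ENNReal.ofReal (4 * (A + 1536)) * f ω + ENNReal.ofReal (1024 * σ ^ 2 * W ω) ∂μ :=
        lintegral_mono_ae hpath
    _ = ENNReal.ofReal (4 * (A + 1536)) * ∫⁻ ω, f ω ∂μ +
          ENNReal.ofReal (1024 * σ ^ 2) * ∫⁻ ω, ENNReal.ofReal (W ω) ∂μ := by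
        -- Additivity needs measurability of the `W` term alone; the competitors may be arbitrary
        -- functions of `ω`.
        rw [lintegral_add_right' _ (hWmeas.const_mul _).ennreal_ofReal,
          lintegral_const_mul' _ _ ENNReal.ofReal_ne_top]
        simp_rw [ENNReal.ofReal_mul (show 0 ≤ 1024 * σ ^ 2 by positivity)]
        rw [lintegral_const_mul' _ _ ENNReal.ofReal_ne_top]
    _ ≤ ENNReal.ofReal (4 * (A + 1536)) * ∫⁻ ω, f ω ∂μ +
          ENNReal.ofReal 16384 * ∫⁻ ω, f ω ∂μ := by
        refine add_le_add le_rfl ?_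
        calc _ ≤ ENNReal.ofReal (1024 * σ ^ 2) * 16 := by gcongr
          _ = ENNReal.ofReal 16384 * ENNReal.ofReal (σ ^ 2) := by
            rw [← ENNReal.ofReal_ofNat 16, ← ENNReal.ofReal_mul (by positivity),
              ← ENNReal.ofReal_mul (by positivity)]
            congr 1
            ring
          _ ≤ _ := by gcongr
    _ = ENNReal.ofReal (4 * (A + 1536) + 16384) * ∫⁻ ω, f ω ∂μ := by
        rw [ENNReal.ofReal_add (by linarith) (by norm_num), add_mul]
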